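/- Let $n>1$ and let $P=P(\rho,S)$ be a smooth function on $\{\rho>0,\ S\in\mathbb R\}$. Consider smooth solutions $(\mathbf u,\rho,S)$ with $\rho>0$, on open regions of space-time $\mathbb R\times\mathbb R^n$, of the compressible Euler equations $$\partial_t\mathbf u+\mathbf u\cdot\nabla\mathbf u+\tfrac1\rho\nabla p=0,\qquad \partial_t\rho+\nabla\cdot(\rho\mathbf u)=0,\qquad \partial_tS+\mathbf u\cdot\nabla S=0,\qquad p=P(\rho,S).$$ Call a smooth function $T(t,\mathbf x,\mathbf u,\rho,S)$ (defined for $\rho>0$) *conserved* if $$\frac{d}{dt}\int_{V(t)}T(t,\mathbf x,\mathbf u,\rho,S)\,d^nx=0$$ for all such solutions and all bounded domains $V(t)$ transported by the flow of $\mathbf u$ (the closure of the initial domain lying in the domain of the flow map). Call it *trivial* if $T$ is identically a spatial divergence $\operatorname{div}\boldsymbol\Theta$ with $\boldsymbol\Theta$ a smooth function of $t,\mathbf x,\mathbf u,\rho,S$ and finitely many $\mathbf x$-derivatives of $\mathbf u,\rho,S$. A *kinematic constant of motion* is given by a $T$ that is conserved and not trivial. Then: 1. For every equation of state $P$, the mass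 $\int_{V(t)}\rho\,d^nx$ and the generalized entropy $\int_{V(t)}\rho f(S)\,d^nx$, for every smooth $f\not\equiv0$, are kinematic constants of motion. 2. There are no others. Suppose that for a dense set of values $S$ there is a $\rho>0$ with $(\partial_\rho P,\partial_SP)(\rho,S)\neq(0,0)$; this holds for instance if $\partial P/\partial S$ vanishes identically on no nonempty open set (as for analytic $P$ with $\partial P/\partial S\not\equiv0$), and for every barotropic $p=P(\rho)$ with $P'\not\equiv0$. Then every conserved $T$ has the form $T=\rho f(S)$ for some smooth $f$. In particular no special equation of state of this kind, and no special dimension, gives further constants of motion. 3. For isentropic flow with constant entropy $S\equiv s_0$, if $\partial_\rho P(\rho,s_0)\neq0$ for some $\rho>0$, then every $T$ that is conserved for all solutions with $S\equiv s_0$ is, at $S=s_0$, a constant multiple of $\rho$. -/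

import Mathlib

open Set MeasureTheory
open scoped ContDiff

noncomputable section

namespace CompressibleFluid

/-- Euclidean space of dimension `n`. -/
abbrev Space (n : ℕ) : Type := EuclideanSpace ℝ (Fin n)

/-- The divergence `∑ᵢ ∂vⁱ/∂xⁱ` of a vector field on Euclidean space. -/
def divergence {n : ℕ} (v : Space n → Space n) (x : Space n) : ℝ :=
  ∑ i, fderiv ℝ v x (EuclideanSpace.single i 1) i

/-- An equation of state `p = P(ρ, S)`, smooth on the physical range `ρ > 0`, `S ∈ ℝ`. -/
def SmoothState (P : ℝ → ℝ → ℝ) : Prop :=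
  ContDiffOn ℝ ∞ (fun z : ℝ × ℝ => P z.1 z.2) {z | 0 < z.1}

/-- The pressure really enters the dynamics: for a dense set of entropy values `s` there is a
density `r > 0` at which the differential of `P` does not vanish. -/
def NondegenerateState (P : ℝ → ℝ → ℝ) : Prop :=
  Dense {s : ℝ | ∃ r : ℝ, 0 < r ∧
    (deriv (fun r' => P r' s) r ≠ 0 ∨ deriv (fun s' => P r s') s ≠ 0)}

/-- `(u, ρ, S)` is a smooth solution with `ρ > 0` of the compressible Euler equations with
equation of state `p = P(ρ, S)` on the open space-time region `Ω`. -/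
structure IsEulerSolution {n : ℕ} (P : ℝ → ℝ → ℝ) (Ω : Set (ℝ × Space n))
    (u : ℝ → Space n → Space n) (ρ S : ℝ → Space n → ℝ) : Prop where
  isOpen : IsOpen Ω
  smooth_velocity : ContDiffOn ℝ ∞ (fun z : ℝ × Space n => u z.1 z.2) Ω
  smooth_density : ContDiffOn ℝ ∞ (fun z : ℝ × Space n => ρ z.1 z.2) Ω
  smooth_entropy : ContDiffOn ℝ ∞ (fun z : ℝ × Space n => S z.1 z.2) Ω
  density_pos : ∀ t x, (t, x) ∈ Ω → 0 < ρ t x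
  /-- `∂ₜu + u·∇u + ρ⁻¹ ∇p = 0` -/
  momentum : ∀ t x, (t, x) ∈ Ω →
    deriv (fun s => u s x) t + fderiv ℝ (fun y => u t y) x (u t x)
      + (ρ t x)⁻¹ • gradient (fun y => P (ρ t y) (S t y)) x = 0
  /-- `∂ₜρ + ∇·(ρu) = 0` -/
  continuity : ∀ t x, (t, x) ∈ Ω →
    deriv (fun s => ρ s x) t + divergence (fun y => ρ t y • u t y) x = 0
  /-- `∂ₜS + u·∇S = 0` -/
  entropy : ∀ t x, (t, x) ∈ Ω →
    deriv (fun s => S s x) t + fderiv ℝ (fun y => S t y) x (u t x) = 0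

/-- `φ` is the (smooth) flow map of the velocity field `u` over the time interval `(a, b)`,
labelling the fluid particles by their position in the open set `W` at time `t₀`. -/
structure IsFlowMap {n : ℕ} (Ω : Set (ℝ × Space n)) (u : ℝ → Space n → Space n)
    (a t₀ b : ℝ) (W : Set (Space n)) (φ : ℝ → Space n → Space n) : Prop where
  time_mem : t₀ ∈ Ioo a b
  isOpen : IsOpen W
  smooth : ContDiffOn ℝ ∞ (fun z : ℝ × Space n => φ z.1 z.2) (Ioo a b ×ˢ W)
  initial : ∀ x ∈ W, φ t₀ x = x
  mem_region : ∀ t ∈ Ioo a b, ∀ x ∈ W, (t, φ t x) ∈ Ω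
  velocity : ∀ t ∈ Ioo a b, ∀ x ∈ W, HasDerivAt (fun s => φ s x) (u t (φ t x)) t

/-- A kinematic density `T(t, x, u, ρ, S)`, smooth on the range `ρ > 0`. -/
def SmoothDensity {n : ℕ} (T : ℝ → Space n → Space n → ℝ → ℝ → ℝ) : Prop :=
  ContDiffOn ℝ ∞ (fun z : ℝ × Space n × Space n × ℝ × ℝ =>
    T z.1 z.2.1 z.2.2.1 z.2.2.2.1 z.2.2.2.2) {z | 0 < z.2.2.2.1}

/-- `d/dt ∫_{V(t)} T(t, x, u, ρ, S) dⁿx = 0` for every solution of the Euler equations whose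
entropy takes values in `A`, and every bounded domain `V(t) = φ t '' V₀` moving with the fluid.
The case `A = univ` is that of general flows, and `A = {s₀}` that of flows in which the entropy
is the constant `s₀`. -/
def IsConserved {n : ℕ} (P : ℝ → ℝ → ℝ) (A : Set ℝ)
    (T : ℝ → Space n → Space n → ℝ → ℝ → ℝ) : Prop :=
  ∀ (Ω : Set (ℝ × Space n)) (u : ℝ → Space n → Space n) (ρ S : ℝ → Space n → ℝ),
    IsEulerSolution P Ω u ρ S → (∀ t x, (t, x) ∈ Ω → S t x ∈ A) →
    ∀ (a t₀ b : ℝ) (W : Set (Space n)) (φ : ℝ → Space n → Space n),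
      IsFlowMap Ω u a t₀ b W φ →
      ∀ V₀ : Set (Space n), IsOpen V₀ → IsConnected V₀ → Bornology.IsBounded V₀ →
        closure V₀ ⊆ W →
        ∀ t ∈ Ioo a b,
          IntegrableOn (fun x => T t x (u t x) (ρ t x) (S t x)) (φ t '' V₀) ∧
          HasDerivAt (fun s => ∫ x in φ s '' V₀, T s x (u s x) (ρ s x) (S s x)) 0 t

/-- The values of the fluid variables `(u, ρ, S)` at a point. -/
abbrev FluidState (n : ℕ) : Type := Space n × ℝ × ℝ

/-- The derivatives of orders `1, …, k` of `(u, ρ, S)` with respect to `x` at a point. -/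
abbrev DerivativeJet (n k : ℕ) : Type :=
  (j : Fin k) → ContinuousMultilinearMap ℝ (fun _ : Fin (j + 1) => Space n) (FluidState n)

/-- The density `T` is locally trivial: it is identically a spatial divergence `div Θ`, where `Θ`
is a smooth function of `t, x, u, ρ, S` and finitely many `x`-derivatives of `u, ρ, S`. -/
def IsTrivialDensity {n : ℕ} (T : ℝ → Space n → Space n → ℝ → ℝ → ℝ) : Prop :=
  ∃ (k : ℕ) (Θ : ℝ × Space n × FluidState n × DerivativeJet n k → Space n),
    ContDiffOn ℝ ∞ Θ {z | 0 < z.2.2.1.2.1} ∧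
    ∀ w : Space n → FluidState n, ContDiff ℝ ∞ w → (∀ x, 0 < (w x).2.1) →
      ∀ t x, T t x (w x).1 (w x).2.1 (w x).2.2 =
        divergence (fun y => Θ (t, y, w y, fun j => iteratedFDeriv ℝ (j + 1) w y)) x

/-- `∫_{V(t)} T dⁿx` is a moving-domain constant of motion: it is conserved on all domains
moving with the fluid, and its density is not locally trivial. -/
def IsConstantOfMotion {n : ℕ} (P : ℝ → ℝ → ℝ)
    (T : ℝ → Space n → Space n → ℝ → ℝ → ℝ) : Prop :=
  IsConserved P univ T ∧ ¬ IsTrivialDensity T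

end CompressibleFluid

end

/-! The quantity `T / ρ` of a conserved density is constant along particle paths, because `ρ dx` is
transported by the flow; comparing exact solutions which pass through the same state then pins `T`
down. Explosions `u = x / t` change the density at will, so together with free motion they force
`T` to be proportional to `ρ`. A vortex in centrifugal balance and a free motion through the same
state differ, to first order in time, only in the acceleration of the particle; hence `T` does not
depend on the velocity. Such vortices exist near every state at which the pressure varies, in any
centripetal direction, as `n > 1`. A free motion finally joins any two points at different times,
so `T` does not depend on `(t, x)` either. The densities `ρ f(S)` are not trivial because a
divergence is a null Lagrangian: its integral does not change under compactly supported
perturbations of the fluid variables. -/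

noncomputable section

namespace CompressibleFluid

section Determinant

variable {E : Type*} [NormedAddCommGroup E] [NormedSpace ℝ E] [FiniteDimensional ℝ E]

theorem differentiable_det : Differentiable ℝ (fun A : E →L[ℝ] E => A.det) := by
  let b := Module.finBasis ℝ E
  have hdet (A : E →L[ℝ] E) : A.det = ∑ σ : Equiv.Perm (Fin (Module.finrank ℝ E)),
      (Equiv.Perm.sign σ : ℝ) * ∏ i, (b.coord (σ i)).toContinuousLinearMap (A (b i)) := by
    rw [ContinuousLinearMap.det, ← LinearMap.det_toMatrix b, Matrix.det_apply']
    simp [LinearMap.toMatrix_apply]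
  simp only [hdet]
  fun_prop

theorem hasDerivAt_det_one_add_smul (B : E →L[ℝ] E) :
    HasDerivAt (fun r : ℝ => (1 + r • B).det) (LinearMap.trace ℝ E B) 0 := by
  let b := Module.finBasis ℝ E
  let M := LinearMap.toMatrix b b (B : E →ₗ[ℝ] E)
  have hdet : (fun r : ℝ => (1 + r • B).det) = fun r =>
      1 + M.trace * r +
        (1 + (Polynomial.X : Polynomial ℝ) • M.map Polynomial.C).det.divX.divX.eval r * r ^ 2 := by
    funext r
    rw [← Matrix.det_one_add_smul, ContinuousLinearMap.det, ← LinearMap.det_toMatrix b]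
    congr 1
    simp [M, LinearMap.toMatrix_one]
  rw [hdet, LinearMap.trace_eq_matrix_trace ℝ b]
  have hlin := ((hasDerivAt_id (0 : ℝ)).const_mul M.trace).const_add 1
  refine (hlin.fun_add ((Polynomial.hasDerivAt _ 0).fun_mul
    (hasDerivAt_pow 2 (0 : ℝ)))).congr_deriv ?_
  simp [M]

theorem hasDerivAt_det {A : ℝ → E →L[ℝ] E} {B : E →L[ℝ] E} {t : ℝ}
    (h : HasDerivAt A (B ∘L A t) t) :
    HasDerivAt (fun s => (A s).det) (LinearMap.trace ℝ E B * (A t).det) t := by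
  have hD := (differentiable_det (A t)).hasFDerivAt
  have hline : HasDerivAt (fun r : ℝ => A t + r • (B ∘L A t)) (B ∘L A t) 0 := by
    simpa using ((hasDerivAt_id (0 : ℝ)).smul_const (B ∘L A t)).const_add (A t)
  have hprod : (fun r : ℝ => (A t + r • (B ∘L A t)).det) =
      fun r => (1 + r • B).det * (A t).det := by
    funext r
    rw [ContinuousLinearMap.det, ContinuousLinearMap.det, ContinuousLinearMap.det,
      ← LinearMap.det_comp]
    congr 1
  have hdir : fderiv ℝ (fun C : E →L[ℝ] E => C.det) (A t) (B ∘L A t) =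
      LinearMap.trace ℝ E B * (A t).det := by
    have hcomp := HasFDerivAt.comp_hasDerivAt_of_eq 0 hD hline (by simp)
    refine HasDerivAt.unique hcomp ?_
    simpa only [Function.comp_def, hprod] using
      (hasDerivAt_det_one_add_smul B).mul_const (A t).det
  rw [← hdir]
  exact hD.comp_hasDerivAt t h

end Determinant

section Slices

variable {E G : Type*} [NormedAddCommGroup E] [NormedSpace ℝ E] [NormedAddCommGroup G]
  [NormedSpace ℝ G]

theorem hasDerivAt_fderiv_comm {ψ : ℝ → E → G} {t : ℝ} {x : E}
    (hψ : ContDiffAt ℝ 2 (fun z : ℝ × E => ψ z.1 z.2) (t, x)) :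
    HasDerivAt (fun s => fderiv ℝ (ψ s) x)
      (fderiv ℝ (fun y => deriv (fun s => ψ s y) t) x) t := by
  set F : ℝ × E → G := fun z => ψ z.1 z.2
  have hd : ∀ᶠ z in nhds (t, x), DifferentiableAt ℝ F z :=
    (hψ.eventually (by simp)).mono fun z hz => hz.differentiableAt (by simp)
  have hF' : HasFDerivAt (fderiv ℝ F) (fderiv ℝ (fderiv ℝ F) (t, x)) (t, x) :=
    ((hψ.fderiv_right (m := 1) (by norm_num)).differentiableAt (by simp)).hasFDerivAt
  have hspace : ∀ᶠ s in nhds t,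
      fderiv ℝ (ψ s) x = (fderiv ℝ F (s, x)).comp (ContinuousLinearMap.inr ℝ ℝ E) := by
    filter_upwards [(Continuous.prodMk_left x).continuousAt.eventually hd] with s hs
    exact (hs.hasFDerivAt.comp x (hasFDerivAt_prodMk_right s x)).fderiv
  have htime : ∀ᶠ y in nhds x, deriv (fun s => ψ s y) t = fderiv ℝ F (t, y) (1, 0) := by
    filter_upwards [(Continuous.prodMk_right t).continuousAt.eventually hd] with y hy
    exact (hy.hasFDerivAt.comp_hasDerivAt t ((hasDerivAt_id t).prodMk (hasDerivAt_const t y))).deriv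
  have hmixed : fderiv ℝ (fun y => deriv (fun s => ψ s y) t) x =
      (fderiv ℝ (fderiv ℝ F) (t, x) (1, 0)).comp (ContinuousLinearMap.inr ℝ ℝ E) := by
    have hslice : HasFDerivAt (fun y => fderiv ℝ F (t, y))
        ((fderiv ℝ (fderiv ℝ F) (t, x)).comp (ContinuousLinearMap.inr ℝ ℝ E)) x :=
      hF'.comp x (hasFDerivAt_prodMk_right t x)
    rw [Filter.EventuallyEq.fderiv_eq htime,
      (hslice.clm_apply (hasFDerivAt_const ((1 : ℝ), (0 : E)) x)).fderiv]
    ext h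
    simp [hψ.isSymmSndFDerivAt (by simp) (1, 0) (0, h)]
  have hcurve : HasDerivAt (fun s => fderiv ℝ F (s, x)) (fderiv ℝ (fderiv ℝ F) (t, x) (1, 0)) t :=
    hF'.comp_hasDerivAt t ((hasDerivAt_id t).prodMk (hasDerivAt_const t x))
  rw [hmixed]
  refine HasDerivAt.congr_of_eventuallyEq ?_ hspace
  simpa using hcurve.clm_comp (hasDerivAt_const t (ContinuousLinearMap.inr ℝ ℝ E))

variable {Ω : Set (ℝ × E)} {ψ : ℝ → E → G} {t : ℝ} {x : E}

theorem contDiffAt_slice (hΩ : IsOpen Ω)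
    (h : ContDiffOn ℝ ∞ (fun z : ℝ × E => ψ z.1 z.2) Ω) (hz : (t, x) ∈ Ω) :
    ContDiffAt ℝ ∞ (ψ t) x :=
  ContDiffAt.comp (g := fun z : ℝ × E => ψ z.1 z.2) x (h.contDiffAt (hΩ.mem_nhds hz))
    (contDiffAt_const.prodMk contDiffAt_id)

theorem differentiableAt_slice (hΩ : IsOpen Ω)
    (h : ContDiffOn ℝ ∞ (fun z : ℝ × E => ψ z.1 z.2) Ω) (hz : (t, x) ∈ Ω) :
    DifferentiableAt ℝ (ψ t) x :=
  (contDiffAt_slice hΩ h hz).differentiableAt (by simp)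

theorem hasDerivAt_along_curve {γ : ℝ → E} {v : E}
    (h : DifferentiableAt ℝ (fun z : ℝ × E => ψ z.1 z.2) (t, γ t)) (hγ : HasDerivAt γ v t) :
    HasDerivAt (fun s => ψ s (γ s))
      (deriv (fun s => ψ s (γ t)) t + fderiv ℝ (ψ t) (γ t) v) t := by
  obtain ⟨D, hD⟩ : ∃ D, HasFDerivAt (fun z : ℝ × E => ψ z.1 z.2) D (t, γ t) := h
  have htime : HasDerivAt (fun s => ψ s (γ t)) (D (1, 0)) t :=
    HasFDerivAt.comp_hasDerivAt (l := fun z : ℝ × E => ψ z.1 z.2)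
      (f := fun s => (s, γ t)) t hD ((hasDerivAt_id t).prodMk (hasDerivAt_const t (γ t)))
  have hspace : HasFDerivAt (ψ t) (D ∘L ContinuousLinearMap.inr ℝ ℝ E) (γ t) :=
    hD.comp (γ t) (hasFDerivAt_prodMk_right t (γ t))
  have hcurve : HasDerivAt (fun s => ψ s (γ s)) (D (1, v)) t :=
    HasFDerivAt.comp_hasDerivAt (l := fun z : ℝ × E => ψ z.1 z.2)
      (f := fun s => (s, γ s)) t hD ((hasDerivAt_id t).prodMk hγ)
  rw [htime.deriv, hspace.fderiv]
  simpa [← map_add, Prod.mk_add_mk] using hcurve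

end Slices

section IntegralCurves

variable {E : Type*} [NormedAddCommGroup E] [NormedSpace ℝ E] {Ω : Set (ℝ × E)} {u : ℝ → E → E}
  {f g : ℝ → E}

theorem eventuallyEq_of_hasDerivAt {t : ℝ}
    (hu : ContDiffAt ℝ 1 (fun z : ℝ × E => u z.1 z.2) (t, f t))
    (hf : ∀ᶠ s in nhds t, HasDerivAt f (u s (f s)) s)
    (hg : ∀ᶠ s in nhds t, HasDerivAt g (u s (g s)) s) (heq : f t = g t) : f =ᶠ[nhds t] g := by
  obtain ⟨K, N, hN, hK⟩ := hu.exists_lipschitzOnWith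
  have hmem (k : ℝ → E) (hk : k t = f t) (hd : HasDerivAt k (u t (k t)) t) :
      ∀ᶠ s in nhds t, (s, k s) ∈ N :=
    (continuousAt_id.prodMk hd.continuousAt).eventually (by simpa [hk] using hN)
  refine ODE_solution_unique_of_eventually (v := u) (s := fun s => {y | (s, y) ∈ N}) (K := K)
    (Filter.Eventually.of_forall fun s y hy y' hy' => ?_)
    (hf.and (hmem f rfl hf.self_of_nhds)) (hg.and (hmem g heq.symm hg.self_of_nhds)) heq
  simpa [Prod.edist_eq] using hK hy hy'

theorem eqOn_Ioo_of_hasDerivAt {a b t : ℝ} (hΩ : IsOpen Ω)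
    (hu : ContDiffOn ℝ 1 (fun z : ℝ × E => u z.1 z.2) Ω)
    (hfΩ : ∀ s ∈ Ioo a b, (s, f s) ∈ Ω) (hf : ∀ s ∈ Ioo a b, HasDerivAt f (u s (f s)) s)
    (hg : ∀ s ∈ Ioo a b, HasDerivAt g (u s (g s)) s) (ht : t ∈ Ioo a b) (heq : f t = g t) :
    EqOn f g (Ioo a b) := by
  have hlocal (s : ℝ) (hs : s ∈ Ioo a b) (h : f s = g s) : f =ᶠ[nhds s] g :=
    eventuallyEq_of_hasDerivAt (hu.contDiffAt (hΩ.mem_nhds (hfΩ s hs)))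
      (Filter.eventually_of_mem (isOpen_Ioo.mem_nhds hs) hf)
      (Filter.eventually_of_mem (isOpen_Ioo.mem_nhds hs) hg) h
  have hcont (k : ℝ → E) (hk : ∀ s ∈ Ioo a b, HasDerivAt k (u s (k s)) s) :
      ContinuousOn k (Ioo a b) := fun s hs => (hk s hs).continuousAt.continuousWithinAt
  have hne : IsOpen (Ioo a b ∩ {s | f s ≠ g s}) :=
    ((hcont f hf).prodMk (hcont g hg)).isOpen_inter_preimage isOpen_Ioo
      isClosed_diagonal.isOpen_compl
  have hsub : Ioo a b ⊆ {s | f =ᶠ[nhds s] g} := by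
    refine isPreconnected_Ioo.subset_left_of_subset_union isOpen_setOfPred_eventually_nhds hne ?_
      (fun s hs => ?_) ⟨t, ht, hlocal t ht heq⟩
    · exact disjoint_left.2 fun s hs hs' => hs'.2 hs.self_of_nhds
    · exact (eq_or_ne (f s) (g s)).imp (hlocal s hs) fun h => ⟨hs, h⟩
  exact fun s hs => (hsub hs).self_of_nhds

theorem eq_of_hasDerivAt_zero_Ioo {f : ℝ → E} {a b : ℝ} (h : ∀ t ∈ Ioo a b, HasDerivAt f 0 t)
    {s t : ℝ} (hs : s ∈ Ioo a b) (ht : t ∈ Ioo a b) : f s = f t :=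
  isOpen_Ioo.is_const_of_deriv_eq_zero isPreconnected_Ioo
    (fun r hr => (h r hr).differentiableAt.differentiableWithinAt)
    (fun r hr => (h r hr).deriv) hs ht

end IntegralCurves

section Divergence

variable {n : ℕ} {x : Space n}

theorem divergence_eq_trace (v : Space n → Space n) (x : Space n) :
    divergence v x = LinearMap.trace ℝ (Space n) (fderiv ℝ v x) := by
  let b := (EuclideanSpace.basisFun (Fin n) ℝ).toBasis
  rw [LinearMap.trace_eq_matrix_trace ℝ b]
  simp [divergence, Matrix.trace, b, LinearMap.toMatrix_apply]

theorem divergence_smul {f : Space n → ℝ} {v : Space n → Space n} (hf : DifferentiableAt ℝ f x)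
    (hv : DifferentiableAt ℝ v x) :
    divergence (fun y => f y • v y) x = fderiv ℝ f x (v x) + f x * divergence v x := by
  rw [divergence_eq_trace, divergence_eq_trace, fderiv_fun_smul hf hv]
  simp [LinearMap.trace_smulRight, add_comm]

theorem divergence_sub {v w : Space n → Space n} (hv : DifferentiableAt ℝ v x)
    (hw : DifferentiableAt ℝ w x) :
    divergence (fun y => v y - w y) x = divergence v x - divergence w x := by
  simp [divergence, fderiv_fun_sub hv hw]

end Divergence

section FlowMap

variable {n : ℕ} {Ω : Set (ℝ × Space n)} {u : ℝ → Space n → Space n} {a t₀ b t : ℝ}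
  {W : Set (Space n)} {φ : ℝ → Space n → Space n} {x : Space n}

theorem IsFlowMap.initial_mem_region (hφ : IsFlowMap Ω u a t₀ b W φ) (hx : x ∈ W) :
    (t₀, x) ∈ Ω := by
  simpa [hφ.initial x hx] using hφ.mem_region t₀ hφ.time_mem x hx

theorem IsFlowMap.contDiffAt (hφ : IsFlowMap Ω u a t₀ b W φ) (ht : t ∈ Ioo a b) (hx : x ∈ W) :
    ContDiffAt ℝ ∞ (φ t) x :=
  contDiffAt_slice (isOpen_Ioo.prod hφ.isOpen) hφ.smooth ⟨ht, hx⟩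

theorem IsFlowMap.hasFDerivAt (hφ : IsFlowMap Ω u a t₀ b W φ) (ht : t ∈ Ioo a b) (hx : x ∈ W) :
    HasFDerivAt (φ t) (fderiv ℝ (φ t) x) x :=
  ((hφ.contDiffAt ht hx).differentiableAt (by simp)).hasFDerivAt

theorem IsFlowMap.hasDerivAt_fderiv (hφ : IsFlowMap Ω u a t₀ b W φ)
    (hu : DifferentiableAt ℝ (u t) (φ t x)) (ht : t ∈ Ioo a b) (hx : x ∈ W) :
    HasDerivAt (fun s => fderiv ℝ (φ s) x) (fderiv ℝ (u t) (φ t x) ∘L fderiv ℝ (φ t) x) t := by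
  have hvelocity : (fun y => deriv (fun s => φ s y) t) =ᶠ[nhds x] u t ∘ φ t :=
    Filter.eventually_of_mem (hφ.isOpen.mem_nhds hx) fun y hy => (hφ.velocity t ht y hy).deriv
  have hcomm := hasDerivAt_fderiv_comm (ψ := φ)
    ((hφ.smooth.contDiffAt ((isOpen_Ioo.prod hφ.isOpen).mem_nhds ⟨ht, hx⟩)).of_le (by norm_cast))
  rwa [hvelocity.fderiv_eq, (hu.hasFDerivAt.comp x (hφ.hasFDerivAt ht hx)).fderiv] at hcomm

theorem IsFlowMap.hasDerivAt_det (hφ : IsFlowMap Ω u a t₀ b W φ)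
    (hu : DifferentiableAt ℝ (u t) (φ t x)) (ht : t ∈ Ioo a b) (hx : x ∈ W) :
    HasDerivAt (fun s => (fderiv ℝ (φ s) x).det)
      (divergence (u t) (φ t x) * (fderiv ℝ (φ t) x).det) t := by
  rw [divergence_eq_trace]
  exact CompressibleFluid.hasDerivAt_det (hφ.hasDerivAt_fderiv hu ht hx)

theorem IsFlowMap.det_initial (hφ : IsFlowMap Ω u a t₀ b W φ) (hx : x ∈ W) :
    (fderiv ℝ (φ t₀) x).det = 1 := by
  have hid : φ t₀ =ᶠ[nhds x] id := Filter.eventually_of_mem (hφ.isOpen.mem_nhds hx) hφ.initial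
  rw [hid.fderiv_eq, fderiv_id]
  exact LinearMap.det_id

theorem IsFlowMap.injOn (hφ : IsFlowMap Ω u a t₀ b W φ) (hΩ : IsOpen Ω)
    (hu : ContDiffOn ℝ 1 (fun z : ℝ × Space n => u z.1 z.2) Ω) (ht : t ∈ Ioo a b) :
    InjOn (φ t) W := by
  intro x hx y hy hxy
  have heq := eqOn_Ioo_of_hasDerivAt hΩ hu (fun s hs => hφ.mem_region s hs x hx)
    (fun s hs => hφ.velocity s hs x hx) (fun s hs => hφ.velocity s hs y hy) ht hxy hφ.time_mem
  simpa [hφ.initial x hx, hφ.initial y hy] using heq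

end FlowMap

section Transport

variable {n : ℕ} {P : ℝ → ℝ → ℝ} {Ω : Set (ℝ × Space n)} {u : ℝ → Space n → Space n}
  {ρ S : ℝ → Space n → ℝ} {a t₀ b t : ℝ} {W V : Set (Space n)} {φ : ℝ → Space n → Space n}
  {x : Space n}

theorem entropy_along_flow (hE : IsEulerSolution P Ω u ρ S) (hφ : IsFlowMap Ω u a t₀ b W φ)
    (ht : t ∈ Ioo a b) (hx : x ∈ W) : S t (φ t x) = S t₀ x := by
  have hconst (s : ℝ) (hs : s ∈ Ioo a b) : HasDerivAt (fun s => S s (φ s x)) 0 s := by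
    have hmem := hφ.mem_region s hs x hx
    rw [← hE.entropy s _ hmem]
    exact hasDerivAt_along_curve ((hE.smooth_entropy.contDiffAt
      (hE.isOpen.mem_nhds hmem)).differentiableAt (by simp)) (hφ.velocity s hs x hx)
  simpa [hφ.initial x hx] using eq_of_hasDerivAt_zero_Ioo hconst ht hφ.time_mem

theorem density_mul_det (hE : IsEulerSolution P Ω u ρ S) (hφ : IsFlowMap Ω u a t₀ b W φ)
    (ht : t ∈ Ioo a b) (hx : x ∈ W) :
    ρ t (φ t x) * (fderiv ℝ (φ t) x).det = ρ t₀ x := by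
  have hconst (s : ℝ) (hs : s ∈ Ioo a b) :
      HasDerivAt (fun s => ρ s (φ s x) * (fderiv ℝ (φ s) x).det) 0 s := by
    have hmem := hφ.mem_region s hs x hx
    have hu := differentiableAt_slice hE.isOpen hE.smooth_velocity hmem
    have hmass := hE.continuity s _ hmem
    rw [divergence_smul (differentiableAt_slice hE.isOpen hE.smooth_density hmem) hu] at hmass
    refine ((hasDerivAt_along_curve ((hE.smooth_density.contDiffAt
      (hE.isOpen.mem_nhds hmem)).differentiableAt (by simp)) (hφ.velocity s hs x hx)).fun_mul
      (hφ.hasDerivAt_det hu hs hx)).congr_deriv ?_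
    linear_combination (fderiv ℝ (φ s) x).det * hmass
  simpa [hφ.initial x hx, hφ.det_initial hx] using
    eq_of_hasDerivAt_zero_Ioo hconst ht hφ.time_mem

theorem abs_det_flow (hE : IsEulerSolution P Ω u ρ S) (hφ : IsFlowMap Ω u a t₀ b W φ)
    (ht : t ∈ Ioo a b) (hx : x ∈ W) :
    |(fderiv ℝ (φ t) x).det| = ρ t₀ x / ρ t (φ t x) := by
  have hpos := hE.density_pos _ _ (hφ.mem_region t ht x hx)
  have hdet : (fderiv ℝ (φ t) x).det = ρ t₀ x / ρ t (φ t x) := by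
    rw [← density_mul_det hE hφ ht hx]
    field_simp
  rw [hdet, abs_of_pos (div_pos (hE.density_pos _ _ (hφ.initial_mem_region hx)) hpos)]

theorem setIntegral_flow (hE : IsEulerSolution P Ω u ρ S) (hφ : IsFlowMap Ω u a t₀ b W φ)
    (hV : MeasurableSet V) (hVW : V ⊆ W) (ht : t ∈ Ioo a b) (g : Space n → ℝ) :
    ∫ x in φ t '' V, g x = ∫ x in V, ρ t₀ x * (g (φ t x) / ρ t (φ t x)) := by
  rw [integral_image_eq_integral_abs_det_fderiv_smul volume hV
    (fun x hx => (hφ.hasFDerivAt ht (hVW hx)).hasFDerivWithinAt)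
    ((hφ.injOn hE.isOpen (hE.smooth_velocity.of_le (by norm_cast)) ht).mono hVW)]
  refine setIntegral_congr_fun hV fun x hx => ?_
  simp only [abs_det_flow hE hφ ht (hVW hx), smul_eq_mul]
  ring

theorem integrableOn_flow_iff (hE : IsEulerSolution P Ω u ρ S)
    (hφ : IsFlowMap Ω u a t₀ b W φ) (hV : MeasurableSet V) (hVW : V ⊆ W) (ht : t ∈ Ioo a b)
    (g : Space n → ℝ) :
    IntegrableOn g (φ t '' V) ↔
      IntegrableOn (fun x => ρ t₀ x * (g (φ t x) / ρ t (φ t x))) V := by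
  rw [integrableOn_image_iff_integrableOn_abs_det_fderiv_smul volume hV
    (fun x hx => (hφ.hasFDerivAt ht (hVW hx)).hasFDerivWithinAt)
    ((hφ.injOn hE.isOpen (hE.smooth_velocity.of_le (by norm_cast)) ht).mono hVW)]
  refine integrableOn_congr_fun (fun x hx => ?_) hV
  simp only [abs_det_flow hE hφ ht (hVW hx), smul_eq_mul]
  ring

theorem isConserved_density_mul {f : ℝ → ℝ} (hf : Continuous f) (A : Set ℝ) :
    IsConserved (n := n) P A (fun _ _ _ ρ S => ρ * f S) := by
  intro Ω u ρ S hE _ a t₀ b W φ hφ V hV _ hVb hclosure t ht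
  have hVW : V ⊆ W := subset_closure.trans hclosure
  have hpullback (s : ℝ) (hs : s ∈ Ioo a b) : EqOn
      (fun x => ρ t₀ x * (ρ s (φ s x) * f (S s (φ s x)) / ρ s (φ s x)))
      (fun x => ρ t₀ x * f (S t₀ x)) V := by
    intro x hx
    have hpos := (hE.density_pos _ _ (hφ.mem_region s hs x (hVW hx))).ne'
    simp only [entropy_along_flow hE hφ hs (hVW hx)]
    field_simp
  constructor
  · rw [integrableOn_flow_iff hE hφ hV.measurableSet hVW ht,
      integrableOn_congr_fun (hpullback t ht) hV.measurableSet]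
    refine (ContinuousOn.integrableOn_compact hVb.isCompact_closure fun x hx => ?_).mono_set
      subset_closure
    have hmem := hφ.initial_mem_region (hclosure hx)
    exact ((contDiffAt_slice hE.isOpen hE.smooth_density hmem).continuousAt.mul
      (hf.continuousAt.comp
        (contDiffAt_slice hE.isOpen hE.smooth_entropy hmem).continuousAt)).continuousWithinAt
  · refine (hasDerivAt_const t (∫ x in V, ρ t₀ x * f (S t₀ x))).congr_of_eventuallyEq ?_
    filter_upwards [isOpen_Ioo.mem_nhds ht] with s hs
    rw [setIntegral_flow hE hφ hV.measurableSet hVW hs]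
    exact setIntegral_congr_fun hV.measurableSet (hpullback s hs)

end Transport

section Localization

theorem eq_of_eventually_setIntegral_ball_eq {X G : Type*} [PseudoMetricSpace X] [ProperSpace X]
    [MeasurableSpace X] [OpensMeasurableSpace X] {μ : Measure X} [IsFiniteMeasureOnCompacts μ]
    [μ.IsOpenPosMeasure] [NormedAddCommGroup G] [NormedSpace ℝ G] [CompleteSpace G] {f g : X → G}
    {x : X} {W : Set X} (hW : IsOpen W) (hx : x ∈ W) (hf : ContinuousOn f W)
    (hg : ContinuousOn g W)
    (h : ∀ᶠ r in nhdsWithin 0 (Ioi 0),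
      ∫ y in Metric.ball x r, f y ∂μ = ∫ y in Metric.ball x r, g y ∂μ) : f x = g x := by
  have hballs : Filter.Tendsto (fun r => Metric.ball x r) (nhdsWithin 0 (Ioi 0))
      (nhds x).smallSets := by
    refine Filter.tendsto_smallSets_iff.2 fun U hU => ?_
    obtain ⟨ε, hε, hεU⟩ := Metric.mem_nhds_iff.1 hU
    filter_upwards [Ioo_mem_nhdsGT hε] with r hr
    exact (Metric.ball_subset_ball hr.2.le).trans hεU
  have hmean (k : X → G) (hk : ContinuousOn k W) :=
    (hk.continuousAt (hW.mem_nhds hx)).integral_sub_linear_isLittleO_ae (μ := μ)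
      (hk.stronglyMeasurableAtFilter hW x hx) hballs
  have hdiff : ∀ ε > 0, ‖g x - f x‖ ≤ ε := by
    intro ε hε
    obtain ⟨r, ⟨hr, heq⟩, hle⟩ := ((eventually_mem_nhdsWithin.and h).and
      (((hmean f hf).sub (hmean g hg)).bound hε)).exists
    have hpos : 0 < μ.real (Metric.ball x r) :=
      ENNReal.toReal_pos (Metric.measure_ball_pos μ x hr).ne' measure_ball_lt_top.ne
    rw [heq, sub_sub_sub_cancel_left, ← smul_sub, norm_smul, mul_comm] at hle
    exact le_of_mul_le_mul_right hle (norm_pos_iff.2 hpos.ne')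
  exact (sub_eq_zero.1 (norm_le_zero_iff.1 (le_of_forall_pos_le_add fun ε hε => by
    simpa using hdiff ε hε))).symm

variable {n : ℕ} {T : ℝ → Space n → Space n → ℝ → ℝ → ℝ}

theorem SmoothDensity.contDiffAt_comp {F : Type*} [NormedAddCommGroup F] [NormedSpace ℝ F]
    (hT : SmoothDensity T) {t : F → ℝ} {x u : F → Space n} {ρ S : F → ℝ} {z : F}
    (ht : ContDiffAt ℝ ∞ t z) (hx : ContDiffAt ℝ ∞ x z) (hu : ContDiffAt ℝ ∞ u z)
    (hρ : ContDiffAt ℝ ∞ ρ z) (hS : ContDiffAt ℝ ∞ S z) (hpos : 0 < ρ z) :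
    ContDiffAt ℝ ∞ (fun z => T (t z) (x z) (u z) (ρ z) (S z)) z := by
  have hopen : IsOpen {z : ℝ × Space n × Space n × ℝ × ℝ | 0 < z.2.2.2.1} :=
    isOpen_lt (by fun_prop) (by fun_prop)
  exact ContDiffAt.comp (g := fun z : ℝ × Space n × Space n × ℝ × ℝ =>
      T z.1 z.2.1 z.2.2.1 z.2.2.2.1 z.2.2.2.2) z (hT.contDiffAt (hopen.mem_nhds hpos))
    (ht.prodMk (hx.prodMk (hu.prodMk (hρ.prodMk hS))))

variable {P : ℝ → ℝ → ℝ} {Ω : Set (ℝ × Space n)} {u : ℝ → Space n → Space n}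
  {ρ S : ℝ → Space n → ℝ} {A : Set ℝ} {a t₀ b t : ℝ} {W : Set (Space n)}
  {φ : ℝ → Space n → Space n} {x : Space n}

theorem contDiffAt_specific_density_flow (hT : SmoothDensity T) (hE : IsEulerSolution P Ω u ρ S)
    (hφ : IsFlowMap Ω u a t₀ b W φ) (ht : t ∈ Ioo a b) (hx : x ∈ W) :
    ContDiffAt ℝ ∞ (fun y => T t (φ t y) (u t (φ t y)) (ρ t (φ t y)) (S t (φ t y)) /
      ρ t (φ t y)) x := by
  have hmem := hφ.mem_region t ht x hx
  have hpos := hE.density_pos _ _ hmem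
  have hφx := hφ.contDiffAt ht hx
  have hρ := (contDiffAt_slice hE.isOpen hE.smooth_density hmem).comp x hφx
  exact (hT.contDiffAt_comp contDiffAt_const hφx
    ((contDiffAt_slice hE.isOpen hE.smooth_velocity hmem).comp x hφx) hρ
    ((contDiffAt_slice hE.isOpen hE.smooth_entropy hmem).comp x hφx) hpos).div hρ hpos.ne'

theorem IsConserved.specific_density_along_flow (hC : IsConserved P A T) (hT : SmoothDensity T)
    (hE : IsEulerSolution P Ω u ρ S) (hA : ∀ t x, (t, x) ∈ Ω → S t x ∈ A)
    (hφ : IsFlowMap Ω u a t₀ b W φ) (ht : t ∈ Ioo a b) (hx : x ∈ W) :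
    T t (φ t x) (u t (φ t x)) (ρ t (φ t x)) (S t (φ t x)) / ρ t (φ t x) =
      T t₀ x (u t₀ x) (ρ t₀ x) (S t₀ x) / ρ t₀ x := by
  have hcont (s : ℝ) (hs : s ∈ Ioo a b) : ContinuousOn (fun y => ρ t₀ y *
      (T s (φ s y) (u s (φ s y)) (ρ s (φ s y)) (S s (φ s y)) / ρ s (φ s y))) W := fun y hy =>
    ((contDiffAt_slice hE.isOpen hE.smooth_density (hφ.initial_mem_region hy)).mul
      (contDiffAt_specific_density_flow hT hE hφ hs hy)).continuousAt.continuousWithinAt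
  have heq := eq_of_eventually_setIntegral_ball_eq (μ := volume) hφ.isOpen hx (hcont t ht)
    (hcont t₀ hφ.time_mem) <| by
      obtain ⟨ε, hε, hεW⟩ := Metric.nhds_basis_closedBall.mem_iff.1 (hφ.isOpen.mem_nhds hx)
      filter_upwards [Ioo_mem_nhdsGT hε] with r hr
      have hrW := (Metric.closedBall_subset_closedBall hr.2.le).trans hεW
      have hVW := Metric.ball_subset_closedBall.trans hrW
      have hconst := eq_of_hasDerivAt_zero_Ioo (fun s hs => (hC Ω u ρ S hE hA a t₀ b W φ hφ
        (Metric.ball x r) Metric.isOpen_ball (Metric.isConnected_ball hr.1) Metric.isBounded_ball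
        (Metric.closure_ball_subset_closedBall.trans hrW) s hs).2) ht hφ.time_mem
      rwa [setIntegral_flow hE hφ Metric.isOpen_ball.measurableSet hVW ht,
        setIntegral_flow hE hφ Metric.isOpen_ball.measurableSet hVW hφ.time_mem] at hconst
  have hpos := hE.density_pos _ _ (hφ.initial_mem_region hx)
  simpa [hφ.initial x hx, hpos.ne'] using heq

end Localization

section Triviality

theorem integral_fderiv_apply_eq_zero {E : Type*} [NormedAddCommGroup E] [NormedSpace ℝ E]
    [FiniteDimensional ℝ E] [MeasurableSpace E] [BorelSpace E] {μ : Measure E} [μ.IsAddHaarMeasure]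
    {g : E → ℝ} (hg : ContDiff ℝ 1 g) (hsupp : HasCompactSupport g) (e : E) :
    ∫ x, fderiv ℝ g x e ∂μ = 0 := by
  have hint : Integrable (fun x => fderiv ℝ g x e) μ :=
    ((hg.continuous_fderiv (by simp)).clm_apply
      continuous_const).integrable_of_hasCompactSupport (hsupp.fderiv_apply (𝕜 := ℝ) e)
  simpa using integral_mul_fderiv_eq_neg_fderiv_mul_of_integrable (μ := μ)
    (f := fun _ => (1 : ℝ)) (g := g) (v := e) (by simp) (by simpa using hint)
    (by simpa using hg.continuous.integrable_of_hasCompactSupport hsupp)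
    (fun x _ => differentiableAt_const _) (fun x _ => hg.differentiable (by simp) x)

variable {n : ℕ}

theorem integral_divergence_eq_zero {v : Space n → Space n} (hv : ContDiff ℝ 1 v)
    (hsupp : HasCompactSupport v) : ∫ x, divergence v x = 0 := by
  have hcomponent (i : Fin n) : ContDiff ℝ 1 (fun y => v y i) := by fun_prop
  have hsupp_component (i : Fin n) : HasCompactSupport (fun y => v y i) :=
    hsupp.comp_left (g := fun z : Space n => z i) rfl
  have hpartial (i : Fin n) (x : Space n) : fderiv ℝ v x (EuclideanSpace.single i 1) i =
      fderiv ℝ (fun y => v y i) x (EuclideanSpace.single i 1) := by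
    have hproj : HasFDerivAt (fun y => v y i)
        ((EuclideanSpace.proj (𝕜 := ℝ) i : Space n →L[ℝ] ℝ) ∘L fderiv ℝ v x) x :=
      (EuclideanSpace.proj (𝕜 := ℝ) i : Space n →L[ℝ] ℝ).hasFDerivAt.comp x
        (hv.differentiable (by simp) x).hasFDerivAt
    rw [hproj.fderiv]
    rfl
  simp only [divergence, hpartial]
  rw [integral_finsetSum]
  · exact Finset.sum_eq_zero fun i _ =>
      integral_fderiv_apply_eq_zero (hcomponent i) (hsupp_component i) _
  · exact fun i _ => (((hcomponent i).continuous_fderiv (by simp)).clm_apply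
      continuous_const).integrable_of_hasCompactSupport
        ((hsupp_component i).fderiv_apply (𝕜 := ℝ) _)

/-- The `k`-jet at time `t` of a field `w` of fluid states: the argument at which the potential
`Θ` of a trivial density is evaluated. -/
def prolongation (k : ℕ) (t : ℝ) (w : Space n → FluidState n) (x : Space n) :
    ℝ × Space n × FluidState n × DerivativeJet n k :=
  (t, x, w x, fun j => iteratedFDeriv ℝ (j + 1) w x)

theorem contDiff_prolongation {w : Space n → FluidState n} (hw : ContDiff ℝ ∞ w) (k : ℕ) (t : ℝ) :
    ContDiff ℝ ∞ (prolongation k t w) :=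
  contDiff_const.prodMk (contDiff_id.prodMk (hw.prodMk
    (contDiff_pi.2 fun _ => hw.iteratedFDeriv_right (by norm_cast))))

theorem prolongation_eq_of_eventuallyEq {w₁ w₂ : Space n → FluidState n} {x : Space n}
    (h : w₁ =ᶠ[nhds x] w₂) (k : ℕ) (t : ℝ) : prolongation k t w₁ x = prolongation k t w₂ x := by
  simp only [prolongation, h.self_of_nhds, (h.iteratedFDeriv ℝ _).self_of_nhds]

/-- Trivial densities are null Lagrangians. -/
theorem IsTrivialDensity.integral_sub_eq_zero {T : ℝ → Space n → Space n → ℝ → ℝ → ℝ}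
    (hT : IsTrivialDensity T) {w₁ w₂ : Space n → FluidState n} (hw₁ : ContDiff ℝ ∞ w₁)
    (hw₂ : ContDiff ℝ ∞ w₂) (hpos₁ : ∀ x, 0 < (w₁ x).2.1) (hpos₂ : ∀ x, 0 < (w₂ x).2.1)
    (hsupp : HasCompactSupport (w₁ - w₂)) (t : ℝ) :
    ∫ x, (T t x (w₁ x).1 (w₁ x).2.1 (w₁ x).2.2 - T t x (w₂ x).1 (w₂ x).2.1 (w₂ x).2.2) = 0 := by
  obtain ⟨k, Θ, hΘ, hdiv⟩ := hT
  have hflux (w : Space n → FluidState n) (hw : ContDiff ℝ ∞ w) (hpos : ∀ x, 0 < (w x).2.1) :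
      ContDiff ℝ ∞ (fun x => Θ (prolongation k t w x)) :=
    hΘ.comp_contDiff (contDiff_prolongation hw k t) hpos
  have hflux_supp : HasCompactSupport
      (fun x => Θ (prolongation k t w₁ x) - Θ (prolongation k t w₂ x)) := by
    refine HasCompactSupport.intro hsupp fun x hx => ?_
    have heq : w₁ =ᶠ[nhds x] w₂ := by
      filter_upwards [notMem_tsupport_iff_eventuallyEq.1 hx] with y hy using sub_eq_zero.1 hy
    rw [prolongation_eq_of_eventuallyEq heq, sub_self]
  rw [← integral_divergence_eq_zero
    (((hflux w₁ hw₁ hpos₁).sub (hflux w₂ hw₂ hpos₂)).of_le (by norm_cast)) hflux_supp]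
  refine integral_congr_ae (Filter.Eventually.of_forall fun x => ?_)
  simp only [hdiv w₁ hw₁ hpos₁, hdiv w₂ hw₂ hpos₂]
  exact (divergence_sub ((hflux w₁ hw₁ hpos₁).differentiable (by simp) x)
    ((hflux w₂ hw₂ hpos₂).differentiable (by simp) x)).symm

theorem not_isTrivialDensity_density_mul {f : ℝ → ℝ} (hf : f ≠ 0) :
    ¬ IsTrivialDensity (n := n) (fun _ _ _ ρ S => ρ * f S) := by
  intro htrivial
  obtain ⟨s, hs⟩ := Function.ne_iff.1 hf
  let β : ContDiffBump (0 : Space n) := default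
  have hzero := htrivial.integral_sub_eq_zero (w₁ := fun x => (0, 1 + β x, s))
    (w₂ := fun _ => (0, 1, s))
    (contDiff_const.prodMk ((contDiff_const.add β.contDiff).prodMk contDiff_const)) contDiff_const
    (fun x => add_pos_of_pos_of_nonneg one_pos β.nonneg) (fun _ => one_pos)
    (HasCompactSupport.intro β.hasCompactSupport fun x hx => by
      simp [image_eq_zero_of_notMem_tsupport hx]) 0
  simp only [← sub_mul, add_sub_cancel_left, integral_mul_const] at hzero
  exact mul_ne_zero β.integral_pos.ne' hs hzero

theorem isConstantOfMotion_density_mul {P : ℝ → ℝ → ℝ} {f : ℝ → ℝ} (hf : Continuous f)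
    (hf₀ : f ≠ 0) : IsConstantOfMotion (n := n) P (fun _ _ _ ρ S => ρ * f S) :=
  ⟨isConserved_density_mul hf univ, not_isTrivialDensity_density_mul hf₀⟩

end Triviality

section Galilean

variable {n : ℕ} {G : Type*} [NormedAddCommGroup G] [NormedSpace ℝ G]

/-- The field `ψ` transplanted to the frame whose origin moves along `t ↦ c + t • v`. -/
def boost (c v : Space n) (ψ : ℝ → Space n → G) (t : ℝ) (x : Space n) : G :=
  ψ t (x - (c + t • v))

/-- The space-time region `Ω` transplanted to the frame whose origin moves along
`t ↦ c + t • v`. -/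
def boostRegion (c v : Space n) (Ω : Set (ℝ × Space n)) : Set (ℝ × Space n) :=
  {z | (z.1, z.2 - (c + z.1 • v)) ∈ Ω}

variable {Ω : Set (ℝ × Space n)} {c v x : Space n} {ψ : ℝ → Space n → G} {t : ℝ}

theorem contDiffOn_boost (hψ : ContDiffOn ℝ ∞ (fun z : ℝ × Space n => ψ z.1 z.2) Ω) :
    ContDiffOn ℝ ∞ (fun z : ℝ × Space n => boost c v ψ z.1 z.2) (boostRegion c v Ω) :=
  hψ.comp (f := fun z : ℝ × Space n => (z.1, z.2 - (c + z.1 • v)))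
    (by fun_prop) fun _ hz => hz

theorem differentiableAt_boost (h : DifferentiableAt ℝ (ψ t) (x - (c + t • v))) :
    DifferentiableAt ℝ (boost c v ψ t) x :=
  (differentiableAt_comp_sub _).2 h

theorem fderiv_boost : fderiv ℝ (boost c v ψ t) x = fderiv ℝ (ψ t) (x - (c + t • v)) :=
  fderiv_comp_sub _

theorem deriv_boost (hΩ : IsOpen Ω)
    (hψ : ContDiffOn ℝ ∞ (fun z : ℝ × Space n => ψ z.1 z.2) Ω) (h : (t, x) ∈ boostRegion c v Ω) :
    deriv (fun s => boost c v ψ s x) t = deriv (fun s => ψ s (x - (c + t • v))) t -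
      fderiv ℝ (ψ t) (x - (c + t • v)) v := by
  have hγ : HasDerivAt (fun s : ℝ => x - (c + s • v)) (-v) t := by
    simpa using (((hasDerivAt_id t).smul_const v).const_add c).const_sub x
  have hcurve := hasDerivAt_along_curve
    ((hψ.contDiffAt (hΩ.mem_nhds h)).differentiableAt (by simp)) hγ
  rw [map_neg, ← sub_eq_add_neg] at hcurve
  exact hcurve.deriv

variable {P : ℝ → ℝ → ℝ} {u : ℝ → Space n → Space n} {ρ S : ℝ → Space n → ℝ}

theorem IsEulerSolution.galilean (hE : IsEulerSolution P Ω u ρ S) (c v : Space n) :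
    IsEulerSolution P (boostRegion c v Ω) (fun t x => v + boost c v u t x) (boost c v ρ)
      (boost c v S) where
  isOpen := hE.isOpen.preimage (by fun_prop)
  smooth_velocity := contDiffOn_const.add (contDiffOn_boost hE.smooth_velocity)
  smooth_density := contDiffOn_boost hE.smooth_density
  smooth_entropy := contDiffOn_boost hE.smooth_entropy
  density_pos _ _ h := hE.density_pos _ _ h
  momentum t x h := by
    rw [deriv_const_add, fderiv_const_add, deriv_boost hE.isOpen hE.smooth_velocity h,
      ← hE.momentum _ _ h]
    have hgrad : gradient (fun y => P (boost c v ρ t y) (boost c v S t y)) x =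
        gradient (fun y => P (ρ t y) (S t y)) (x - (c + t • v)) :=
      congrArg (InnerProductSpace.toDual ℝ (Space n)).symm
        (fderiv_comp_sub (f := fun y => P (ρ t y) (S t y)) (c + t • v))
    rw [hgrad, fderiv_boost, map_add, boost, boost]
    abel
  continuity t x h := by
    have hu : DifferentiableAt ℝ (u t) (x - (c + t • v)) :=
      differentiableAt_slice hE.isOpen hE.smooth_velocity h
    have hρ : DifferentiableAt ℝ (ρ t) (x - (c + t • v)) :=
      differentiableAt_slice hE.isOpen hE.smooth_density h
    have hmass := hE.continuity _ _ h
    have hdiv : divergence (fun y => v + boost c v u t y) x =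
        divergence (u t) (x - (c + t • v)) := by
      simp only [divergence, fderiv_const_add, fderiv_boost]
    rw [divergence_smul hρ hu] at hmass
    rw [divergence_smul (differentiableAt_boost hρ) ((differentiableAt_boost hu).const_add v), hdiv,
      deriv_boost hE.isOpen hE.smooth_density h, fderiv_boost, map_add, ← hmass, boost, boost]
    ring
  entropy t x h := by
    rw [deriv_boost hE.isOpen hE.smooth_entropy h, fderiv_boost, map_add, ← hE.entropy _ _ h,
      boost]
    ring

theorem IsFlowMap.galilean {a t₀ b : ℝ} {W : Set (Space n)} {φ : ℝ → Space n → Space n}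
    (hφ : IsFlowMap Ω u a t₀ b W φ) (c v : Space n) :
    IsFlowMap (boostRegion c v Ω) (fun t x => v + boost c v u t x) a t₀ b
      {x | x - (c + t₀ • v) ∈ W} (fun t x => c + t • v + φ t (x - (c + t₀ • v))) where
  time_mem := hφ.time_mem
  isOpen := hφ.isOpen.preimage (by fun_prop)
  smooth := by
    refine ContDiffOn.add (by fun_prop) (hφ.smooth.comp
      (f := fun z : ℝ × Space n => (z.1, z.2 - (c + t₀ • v))) (by fun_prop) fun _ hz => hz)
  initial x hx := by simp [hφ.initial _ hx]
  mem_region t ht x hx := by simpa [boostRegion] using hφ.mem_region t ht _ hx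
  velocity t ht x hx := by
    simpa [boost] using (((hasDerivAt_id t).smul_const v).const_add c).fun_add
      (hφ.velocity t ht _ hx)

theorem isEulerSolution_rest (P : ℝ → ℝ → ℝ) {r : ℝ} (hr : 0 < r) (s : ℝ) :
    IsEulerSolution P univ (fun _ (_ : Space n) => 0) (fun _ _ => r) (fun _ _ => s) where
  isOpen := isOpen_univ
  smooth_velocity := contDiffOn_const
  smooth_density := contDiffOn_const
  smooth_entropy := contDiffOn_const
  density_pos _ _ _ := hr
  momentum _ _ _ := by simp [gradient]
  continuity _ _ _ := by simp [divergence]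
  entropy _ _ _ := by simp

theorem isFlowMap_rest {a t₀ b : ℝ} (h : t₀ ∈ Ioo a b) :
    IsFlowMap univ (fun _ (_ : Space n) => 0) a t₀ b univ (fun _ x => x) where
  time_mem := h
  isOpen := isOpen_univ
  smooth := contDiffOn_snd
  initial _ _ := rfl
  mem_region _ _ _ _ := mem_univ _
  velocity t _ x _ := hasDerivAt_const t x

variable {T : ℝ → Space n → Space n → ℝ → ℝ → ℝ} {A : Set ℝ}

theorem IsConserved.density_free_motion (hC : IsConserved P A T) (hT : SmoothDensity T)
    {r s : ℝ} (hr : 0 < r) (hs : s ∈ A) (t t₀ : ℝ) (x u : Space n) :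
    T t (x + (t - t₀) • u) u r s = T t₀ x u r s := by
  have ht₀ : t₀ ∈ Ioo (min t t₀ - 1) (max t t₀ + 1) := by grind
  have ht : t ∈ Ioo (min t t₀ - 1) (max t t₀ + 1) := by grind
  have h := hC.specific_density_along_flow hT ((isEulerSolution_rest P hr s).galilean 0 u)
    (fun _ _ _ => hs) ((isFlowMap_rest ht₀).galilean 0 u) ht (mem_univ x)
  have hpath : t • u + (x - t₀ • u) = x + (t - t₀) • u := by module
  simpa [boost, div_left_inj' hr.ne', hpath] using h

end Galilean

section Explosion

variable {n : ℕ}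

theorem fderiv_const_smul_id (c : ℝ) (x : Space n) :
    fderiv ℝ (fun y => c • y) x = c • ContinuousLinearMap.id ℝ (Space n) :=
  ((hasFDerivAt_id x).const_smul c).fderiv

theorem divergence_const_smul_id (c : ℝ) (x : Space n) : divergence (fun y => c • y) x = n * c := by
  simp [divergence, fderiv_const_smul_id]

theorem isEulerSolution_explosion (P : ℝ → ℝ → ℝ) {r : ℝ} (hr : 0 < r) (s : ℝ) :
    IsEulerSolution P {z : ℝ × Space n | 0 < z.1} (fun t x => t⁻¹ • x) (fun t _ => r / t ^ n)
      (fun _ _ => s) where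
  isOpen := isOpen_lt continuous_const continuous_fst
  smooth_velocity := (contDiffOn_fst.inv fun _ hz => ne_of_gt hz).smul contDiffOn_snd
  smooth_density := contDiffOn_const.div (contDiffOn_fst.pow n) fun _ hz => (pow_pos hz n).ne'
  smooth_entropy := contDiffOn_const
  density_pos _ _ ht := div_pos hr (pow_pos ht n)
  momentum t x ht := by
    have ht' : t ≠ 0 := ne_of_gt ht
    have hdt := (hasDerivAt_inv ht').smul_const x
    have hgrad : gradient (fun _ : Space n => P (r / t ^ n) s) x = 0 := by simp [gradient]
    rw [hgrad, hdt.deriv, fderiv_const_smul_id]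
    simp [smul_smul, sq]
  continuity t x ht := by
    have ht' : t ≠ 0 := ne_of_gt ht
    have hdt := (hasDerivAt_const t r).div (hasDerivAt_pow n t) (pow_ne_zero n ht')
    simp only [smul_smul]
    rw [divergence_const_smul_id]
    refine (congrArg (· + _) hdt.deriv).trans ?_
    rcases n with _ | n
    · simp
    · simp only [Nat.add_sub_cancel]
      field_simp
      ring
  entropy _ _ _ := by simp

theorem isFlowMap_explosion {t₀ b : ℝ} (h₀ : 0 < t₀) (hb : t₀ < b) :
    IsFlowMap {z : ℝ × Space n | 0 < z.1} (fun t x => t⁻¹ • x) 0 t₀ b univ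
      (fun t x => (t / t₀) • x) where
  time_mem := ⟨h₀, hb⟩
  isOpen := isOpen_univ
  smooth := ((contDiff_fst.div_const t₀).smul contDiff_snd).contDiffOn
  initial x _ := by simp [h₀.ne']
  mem_region t ht _ _ := ht.1
  velocity t ht x _ := by
    have ht₀ : t⁻¹ * (t / t₀) = 1 / t₀ := by field_simp [ht.1.ne']
    simpa only [id, smul_smul, ht₀] using ((hasDerivAt_id t).div_const t₀).smul_const x

theorem IsConserved.density_eq_mul {P : ℝ → ℝ → ℝ} {A : Set ℝ}
    {T : ℝ → Space n → Space n → ℝ → ℝ → ℝ} (hC : IsConserved P A T) (hT : SmoothDensity T)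
    (hn : n ≠ 0) {r s : ℝ} (hr : 0 < r) (hs : s ∈ A) (t : ℝ) (x u : Space n) :
    T t x u r s = r * T t x u 1 s := by
  obtain ⟨κ, hκ, hκr⟩ : ∃ κ : ℝ, 0 < κ ∧ κ ^ n = r :=
    ⟨r ^ (n⁻¹ : ℝ), Real.rpow_pos_of_pos hr _, Real.rpow_inv_natCast_pow hr.le hn⟩
  have hexp := hC.specific_density_along_flow hT
    ((isEulerSolution_explosion P hr s).galilean (x - t • u) 0) (fun _ _ _ => hs)
    ((isFlowMap_explosion one_pos (lt_max_of_lt_left (lt_add_one 1))).galilean (x - t • u) 0)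
    (t := κ) ⟨hκ, lt_max_of_lt_right (lt_add_one κ)⟩ (mem_univ (x - t • u + u))
  have hfree (t' : ℝ) {r' : ℝ} (hr' : 0 < r') :
      T t' (x - t • u + t' • u) u r' s = T t x u r' s := by
    rw [← hC.density_free_motion hT hr' hs t' t x u]
    congr 1
    module
  have hfree_one : T 1 (x - t • u + u) u r s = T t x u r s := by simpa using hfree 1 hr
  have hratio : T t x u 1 s = T t x u r s / r := by
    simpa [boost, smul_smul, hκ.ne', hκr, hr.ne', hfree κ one_pos, hfree_one] using hexp
  rw [hratio, mul_div_cancel₀ _ hr.ne']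

end Explosion

section Exponential

theorem contDiff_exp_smul {𝔸 : Type*} [NormedRing 𝔸] [NormedAlgebra ℝ 𝔸] [CompleteSpace 𝔸]
    (a : 𝔸) : ContDiff ℝ ∞ fun θ : ℝ => NormedSpace.exp (θ • a) :=
  contDiff_iff_contDiffAt.2 fun θ => (NormedSpace.exp_analytic (θ • a)).contDiffAt.comp θ
    (contDiff_id.smul contDiff_const).contDiffAt

theorem hasDerivAt_exp_smul_apply {E : Type*} [NormedAddCommGroup E] [NormedSpace ℝ E]
    [CompleteSpace E] (J : E →L[ℝ] E) (θ : ℝ) (x : E) :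
    HasDerivAt (fun θ : ℝ => NormedSpace.exp (θ • J) x) (J (NormedSpace.exp (θ • J) x)) θ :=
  (hasDerivAt_exp_smul_const' J θ).clm_apply (hasDerivAt_const θ x) |>.congr_deriv (by simp)

end Exponential

section Rotation

variable {E : Type*} [NormedAddCommGroup E] [InnerProductSpace ℝ E] {J : E →L[ℝ] E}

/-- The potential, up to sign, of the centrifugal force in the frame rotating with angular
velocity `J`. -/
def centrifugalPotential (J : E →L[ℝ] E) (y : E) : ℝ := ‖J y‖ ^ 2 / 2

theorem contDiff_centrifugalPotential (J : E →L[ℝ] E) : ContDiff ℝ ∞ (centrifugalPotential J) :=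
  (J.contDiff.norm_sq ℝ).div_const 2

variable [CompleteSpace E]

theorem inner_apply_left_of_mem_skewAdjoint (hJ : J ∈ skewAdjoint (E →L[ℝ] E)) (x y : E) :
    inner ℝ (J x) y = -inner ℝ x (J y) := by
  rw [← ContinuousLinearMap.adjoint_inner_right, ← ContinuousLinearMap.star_eq_adjoint,
    skewAdjoint.mem_iff.1 hJ, neg_apply, inner_neg_right]

theorem inner_apply_self_of_mem_skewAdjoint (hJ : J ∈ skewAdjoint (E →L[ℝ] E)) (x : E) :
    inner ℝ x (J x) = 0 := by
  linarith [inner_apply_left_of_mem_skewAdjoint hJ x x, real_inner_comm x (J x)]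

theorem hasFDerivAt_centrifugalPotential (hJ : J ∈ skewAdjoint (E →L[ℝ] E)) (y : E) :
    HasFDerivAt (centrifugalPotential J) (-innerSL ℝ (J (J y))) y := by
  refine (J.hasFDerivAt.norm_sq.mul_const (1 / 2 : ℝ)).congr_fderiv ?_ |>.congr_of_eventuallyEq ?_
  · ext z
    simp [inner_apply_left_of_mem_skewAdjoint hJ (J y) z]
  · exact .of_forall fun z => by simp [centrifugalPotential, div_eq_mul_inv]

theorem centrifugalPotential_exp_smul (hJ : J ∈ skewAdjoint (E →L[ℝ] E)) (θ : ℝ) (x : E) :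
    centrifugalPotential J (NormedSpace.exp (θ • J) x) = centrifugalPotential J x := by
  let +nondep : NormedAlgebra ℚ (E →L[ℝ] E) := .restrictScalars ℚ ℝ _
  have hcomm : Commute J (NormedSpace.exp (θ • J)) := ((Commute.refl J).smul_right θ).exp_right
  have hU : NormedSpace.exp (θ • J) ∈ unitary (E →L[ℝ] E) :=
    NormedSpace.exp_mem_unitary_of_mem_skewAdjoint (skewAdjoint.smul_mem θ hJ)
  have hJU : J (NormedSpace.exp (θ • J) x) = NormedSpace.exp (θ • J) (J x) :=
    congrArg (· x) hcomm.eq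
  rw [centrifugalPotential, centrifugalPotential, hJU,
    ContinuousLinearMap.norm_map_of_mem_unitary hU]

end Rotation

section Vortex

variable {n : ℕ} {J : Space n →L[ℝ] Space n} {f : ℝ → ℝ} {f' : ℝ} {y : Space n}

theorem hasFDerivAt_comp_centrifugalPotential (hJ : J ∈ skewAdjoint (Space n →L[ℝ] Space n))
    (hf : HasDerivAt f f' (centrifugalPotential J y)) :
    HasFDerivAt (fun y => f (centrifugalPotential J y)) (f' • -innerSL ℝ (J (J y))) y :=
  hf.comp_hasFDerivAt y (hasFDerivAt_centrifugalPotential hJ y)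

theorem gradient_comp_centrifugalPotential (hJ : J ∈ skewAdjoint (Space n →L[ℝ] Space n))
    (hf : HasDerivAt f f' (centrifugalPotential J y)) :
    gradient (fun y => f (centrifugalPotential J y)) y = -f' • J (J y) := by
  refine HasGradientAt.gradient (hasGradientAt_iff_hasFDerivAt.2 ?_)
  refine (hasFDerivAt_comp_centrifugalPotential hJ hf).congr_fderiv ?_
  ext z
  simp

theorem fderiv_comp_centrifugalPotential_apply (hJ : J ∈ skewAdjoint (Space n →L[ℝ] Space n))
    (hf : DifferentiableAt ℝ f (centrifugalPotential J y)) :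
    fderiv ℝ (fun y => f (centrifugalPotential J y)) y (J y) = 0 := by
  rw [(hasFDerivAt_comp_centrifugalPotential hJ hf.hasDerivAt).fderiv]
  simp [real_inner_comm (J y), inner_apply_self_of_mem_skewAdjoint hJ]

theorem divergence_of_mem_skewAdjoint (hJ : J ∈ skewAdjoint (Space n →L[ℝ] Space n))
    (y : Space n) : divergence J y = 0 := by
  simp only [divergence, ContinuousLinearMap.fderiv]
  refine Finset.sum_eq_zero fun i _ => ?_
  simpa [EuclideanSpace.inner_single_left] using
    inner_apply_self_of_mem_skewAdjoint hJ (EuclideanSpace.single i 1)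

theorem divergence_comp_centrifugalPotential_smul
    (hJ : J ∈ skewAdjoint (Space n →L[ℝ] Space n))
    (hf : DifferentiableAt ℝ f (centrifugalPotential J y)) :
    divergence (fun y => f (centrifugalPotential J y) • J y) y = 0 := by
  rw [divergence_smul (hasFDerivAt_comp_centrifugalPotential hJ hf.hasDerivAt).differentiableAt
    J.differentiableAt, fderiv_comp_centrifugalPotential_apply hJ hf,
    divergence_of_mem_skewAdjoint hJ, mul_zero, add_zero]

theorem fderiv_comp_centrifugalPotential_smul_apply
    (hJ : J ∈ skewAdjoint (Space n →L[ℝ] Space n))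
    (hf : DifferentiableAt ℝ f (centrifugalPotential J y)) :
    fderiv ℝ (fun y => f (centrifugalPotential J y) • J y) y (J y) =
      f (centrifugalPotential J y) • J (J y) := by
  rw [fderiv_fun_smul (hasFDerivAt_comp_centrifugalPotential hJ hf.hasDerivAt).differentiableAt
    J.differentiableAt]
  simp [fderiv_comp_centrifugalPotential_apply hJ hf]

/-- Radial profiles of a vortex in centrifugal balance: the angular velocity `w`, the density `R`
and the entropy `σ` are functions, on the open set `Z`, of the centrifugal potential. -/
structure IsVortexProfile (P : ℝ → ℝ → ℝ) (Z : Set ℝ) (w R σ : ℝ → ℝ) : Prop where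
  isOpen : IsOpen Z
  smooth_angular_velocity : ContDiffOn ℝ ∞ w Z
  smooth_density : ContDiffOn ℝ ∞ R Z
  smooth_entropy : ContDiffOn ℝ ∞ σ Z
  density_pos : ∀ z ∈ Z, 0 < R z
  balance : ∀ z ∈ Z, HasDerivAt (fun z => P (R z) (σ z)) (R z * w z ^ 2) z

variable {P : ℝ → ℝ → ℝ} {Z : Set ℝ} {w R σ : ℝ → ℝ}

theorem IsVortexProfile.isEulerSolution (h : IsVortexProfile P Z w R σ)
    (hJ : J ∈ skewAdjoint (Space n →L[ℝ] Space n)) :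
    IsEulerSolution P {z : ℝ × Space n | centrifugalPotential J z.2 ∈ Z}
      (fun _ y => w (centrifugalPotential J y) • J y) (fun _ y => R (centrifugalPotential J y))
      (fun _ y => σ (centrifugalPotential J y)) := by
  have hq : ContDiff ℝ ∞ fun z : ℝ × Space n => centrifugalPotential J z.2 :=
    (contDiff_centrifugalPotential J).comp contDiff_snd
  have hdiff {f : ℝ → ℝ} (hf : ContDiffOn ℝ ∞ f Z) {z : ℝ} (hz : z ∈ Z) :
      DifferentiableAt ℝ f z :=
    (hf.contDiffAt (h.isOpen.mem_nhds hz)).differentiableAt (by simp)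
  exact
    { isOpen := h.isOpen.preimage hq.continuous
      smooth_velocity := (h.smooth_angular_velocity.comp hq.contDiffOn fun _ hz => hz).smul
        (J.contDiff.comp contDiff_snd).contDiffOn
      smooth_density := h.smooth_density.comp hq.contDiffOn fun _ hz => hz
      smooth_entropy := h.smooth_entropy.comp hq.contDiffOn fun _ hz => hz
      density_pos := fun _ _ hz => h.density_pos _ hz
      momentum := fun _ y hy => by
        have hR : R (centrifugalPotential J y) ≠ 0 := (h.density_pos _ hy).ne'
        rw [gradient_comp_centrifugalPotential hJ (h.balance _ hy), map_smul,
          fderiv_comp_centrifugalPotential_smul_apply hJ (hdiff h.smooth_angular_velocity hy),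
          deriv_const, zero_add, smul_smul, smul_smul, ← add_smul]
        field_simp
        simp
      continuity := fun _ y hy => by
        simp only [smul_smul, deriv_const, zero_add]
        exact divergence_comp_centrifugalPotential_smul (f := fun z => R z * w z) hJ
          ((hdiff h.smooth_density hy).mul (hdiff h.smooth_angular_velocity hy))
      entropy := fun _ y hy => by
        rw [map_smul, fderiv_comp_centrifugalPotential_apply hJ (hdiff h.smooth_entropy hy),
          deriv_const, smul_zero, add_zero] }

theorem IsVortexProfile.isFlowMap (h : IsVortexProfile P Z w R σ)
    (hJ : J ∈ skewAdjoint (Space n →L[ℝ] Space n)) {a t₀ b : ℝ} (ht₀ : t₀ ∈ Ioo a b) :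
    IsFlowMap {z : ℝ × Space n | centrifugalPotential J z.2 ∈ Z}
      (fun _ y => w (centrifugalPotential J y) • J y) a t₀ b {y | centrifugalPotential J y ∈ Z}
      (fun t y => NormedSpace.exp (((t - t₀) * w (centrifugalPotential J y)) • J) y) where
  time_mem := ht₀
  isOpen := h.isOpen.preimage (contDiff_centrifugalPotential J).continuous
  smooth := by
    have hangle : ContDiffOn ℝ ∞
        (fun z : ℝ × Space n => (z.1 - t₀) * w (centrifugalPotential J z.2))
        (Ioo a b ×ˢ {y | centrifugalPotential J y ∈ Z}) :=
      (contDiff_fst.sub contDiff_const).contDiffOn.mul (h.smooth_angular_velocity.comp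
        ((contDiff_centrifugalPotential J).comp contDiff_snd).contDiffOn fun _ hz => hz.2)
    exact ((contDiff_exp_smul J).comp_contDiffOn hangle).clm_apply contDiffOn_snd
  initial y _ := by
    have hzero : (0 : ℝ) • J = 0 := zero_smul ℝ J
    simp [hzero]
  mem_region t _ y hy := by
    rwa [mem_ofPred_eq, centrifugalPotential_exp_smul hJ]
  velocity t _ y _ := by
    rw [centrifugalPotential_exp_smul hJ]
    exact (hasDerivAt_exp_smul_apply J _ y).scomp t
      (((hasDerivAt_id t).sub_const t₀).mul_const (w (centrifugalPotential J y))) |>.congr_deriv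
        (by simp)

end Vortex

section VelocityIndependence

theorem exists_ne_zero_inner_eq_zero {E : Type*} [NormedAddCommGroup E] [InnerProductSpace ℝ E]
    (hE : 1 < Module.finrank ℝ E) (x : E) : ∃ y : E, y ≠ 0 ∧ inner ℝ x y = 0 := by
  have hne : (Submodule.span ℝ {x})ᗮ ≠ ⊥ := fun h => by
    have htop : Submodule.span ℝ {x} = ⊤ := Submodule.orthogonal_eq_bot_iff.1 h
    have hle := finrank_span_le_card (R := ℝ) {x}
    rw [htop, finrank_top, Set.toFinset_singleton, Finset.card_singleton] at hle
    exact hE.not_ge hle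
  obtain ⟨y, hy, hy₀⟩ := Submodule.exists_mem_ne_zero_of_ne_bot hne
  exact ⟨y, hy₀, Submodule.mem_orthogonal_singleton_iff_inner_right.1 hy⟩

theorem exists_mem_skewAdjoint_apply_apply_eq {E : Type*} [NormedAddCommGroup E]
    [InnerProductSpace ℝ E] [CompleteSpace E] (hE : 1 < Module.finrank ℝ E) (x : E) :
    ∃ J ∈ skewAdjoint (E →L[ℝ] E), ∃ e, J (J e) = x := by
  rcases eq_or_ne x 0 with rfl | hx
  · exact ⟨0, zero_mem _, 0, by simp⟩
  obtain ⟨y, hy, hxy⟩ := exists_ne_zero_inner_eq_zero hE x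
  have hyx : inner ℝ y x = 0 := by rw [real_inner_comm, hxy]
  let J : E →L[ℝ] E := InnerProductSpace.rankOne ℝ y x - InnerProductSpace.rankOne ℝ x y
  have hJx : J x = ‖x‖ ^ 2 • y := by simp [J, hyx]
  have hJy : J y = -‖y‖ ^ 2 • x := by simp [J, hxy]
  refine ⟨J, ?_, -(‖x‖ ^ 2 * ‖y‖ ^ 2)⁻¹ • x, ?_⟩
  · simp [J, skewAdjoint.mem_iff, ContinuousLinearMap.star_eq_adjoint]
  · rw [map_smul, map_smul, hJx, map_smul, hJy, smul_smul, smul_smul]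
    field_simp
    simp

variable {n : ℕ} {T : ℝ → Space n → Space n → ℝ → ℝ → ℝ}

/-- Subtracting the derivatives of `T` along the two motions leaves only its dependence on the
velocity, since they differ to first order only by the acceleration `a`. -/
theorem SmoothDensity.fderiv_velocity_acceleration_eq_zero (hT : SmoothDensity T)
    {γ ν : ℝ → Space n} {a : Space n} {t₀ r s : ℝ} (hr : 0 < r)
    (hγ : HasDerivAt γ (ν t₀) t₀) (hν : HasDerivAt ν a t₀)
    (hpath : ∀ᶠ t in nhds t₀, T t (γ t) (ν t) r s = T t₀ (γ t₀) (ν t₀) r s)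
    (hfree : ∀ᶠ t in nhds t₀,
      T t (γ t₀ + (t - t₀) • ν t₀) (ν t₀) r s = T t₀ (γ t₀) (ν t₀) r s) :
    fderiv ℝ (fun u => T t₀ (γ t₀) u r s) (ν t₀) a = 0 := by
  let ψ : ℝ → Space n × Space n → ℝ := fun t z => T t z.1 z.2 r s
  have hψ : DifferentiableAt ℝ (fun z : ℝ × Space n × Space n => ψ z.1 z.2)
      (t₀, γ t₀, ν t₀) :=
    (hT.contDiffAt_comp contDiffAt_fst (contDiffAt_fst.comp _ contDiffAt_snd)
      (contDiffAt_snd.comp _ contDiffAt_snd) contDiffAt_const contDiffAt_const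
      hr).differentiableAt (by simp)
  have hslice : HasFDerivAt (ψ t₀) (fderiv ℝ (ψ t₀) (γ t₀, ν t₀)) (γ t₀, ν t₀) :=
    ((hT.contDiffAt_comp contDiffAt_const contDiffAt_fst contDiffAt_snd contDiffAt_const
      contDiffAt_const hr).differentiableAt (by simp)).hasFDerivAt
  have hline : HasDerivAt (fun t => γ t₀ + (t - t₀) • ν t₀) (ν t₀) t₀ := by
    simpa using (((hasDerivAt_id t₀).sub_const t₀).smul_const (ν t₀)).const_add (γ t₀)
  have hdpath := (hasDerivAt_along_curve (γ := fun t => (γ t, ν t)) hψ (hγ.prodMk hν)).unique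
    ((hasDerivAt_const t₀ _).congr_of_eventuallyEq hpath)
  have hdfree := (hasDerivAt_along_curve (ψ := ψ) (γ := fun t => (γ t₀ + (t - t₀) • ν t₀, ν t₀))
    (by simpa using hψ) (hline.prodMk (hasDerivAt_const t₀ (ν t₀)))).unique
    ((hasDerivAt_const t₀ _).congr_of_eventuallyEq hfree)
  have hpartial : HasFDerivAt (fun u => T t₀ (γ t₀) u r s)
      (fderiv ℝ (ψ t₀) (γ t₀, ν t₀) ∘L ContinuousLinearMap.inr ℝ (Space n) (Space n)) (ν t₀) :=
    hslice.comp (ν t₀) (hasFDerivAt_prodMk_right (γ t₀) (ν t₀))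
  simp only [sub_self, zero_smul, add_zero] at hdfree
  have hsub : ((0 : Space n), a) = (ν t₀, a) - (ν t₀, 0) := by simp
  rw [hpartial.fderiv, ContinuousLinearMap.comp_apply, ContinuousLinearMap.inr_apply, hsub, map_sub]
  linarith

variable {P : ℝ → ℝ → ℝ} {A Z : Set ℝ} {w R σ : ℝ → ℝ} {J : Space n →L[ℝ] Space n} {e : Space n}

theorem IsConserved.density_vortex_motion (hC : IsConserved P A T) (hT : SmoothDensity T)
    (h : IsVortexProfile P Z w R σ) (hA : ∀ z, σ z ∈ A)
    (hJ : J ∈ skewAdjoint (Space n →L[ℝ] Space n)) {α r s : ℝ}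
    (he : centrifugalPotential J e ∈ Z) (hα : w (centrifugalPotential J e) = α)
    (hr : R (centrifugalPotential J e) = r) (hs : σ (centrifugalPotential J e) = s)
    (t t₀ : ℝ) (c v : Space n) :
    T t (c + t • v + NormedSpace.exp (((t - t₀) * α) • J) e)
        (v + α • J (NormedSpace.exp (((t - t₀) * α) • J) e)) r s =
      T t₀ (c + t₀ • v + e) (v + α • J e) r s := by
  have ht₀ : t₀ ∈ Ioo (min t t₀ - 1) (max t t₀ + 1) := by grind
  have ht : t ∈ Ioo (min t t₀ - 1) (max t t₀ + 1) := by grind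
  have hr₀ : r ≠ 0 := hr ▸ (h.density_pos _ he).ne'
  have hconst := hC.specific_density_along_flow hT ((h.isEulerSolution hJ).galilean c v)
    (fun _ _ _ => hA _) ((h.isFlowMap hJ ht₀).galilean c v) ht (x := c + t₀ • v + e)
    (by simpa using he)
  simpa [boost, centrifugalPotential_exp_smul hJ, hα, hr, hs, div_left_inj' hr₀] using hconst

theorem IsConserved.fderiv_velocity_centripetal_eq_zero (hC : IsConserved P A T)
    (hT : SmoothDensity T) (h : IsVortexProfile P Z w R σ) (hA : ∀ z, σ z ∈ A)
    (hJ : J ∈ skewAdjoint (Space n →L[ℝ] Space n)) {r s : ℝ}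
    (he : centrifugalPotential J e ∈ Z) (hw : w (centrifugalPotential J e) ≠ 0)
    (hr : R (centrifugalPotential J e) = r) (hs : σ (centrifugalPotential J e) = s)
    (t₀ : ℝ) (x₀ u₀ : Space n) :
    fderiv ℝ (fun u => T t₀ x₀ u r s) u₀ (J (J e)) = 0 := by
  set α := w (centrifugalPotential J e) with hα
  have hr₀ : 0 < r := hr ▸ h.density_pos _ he
  let v : Space n := u₀ - α • J e
  let c : Space n := x₀ - (t₀ • v + e)
  let y : ℝ → Space n := fun t => NormedSpace.exp (((t - t₀) * α) • J) e
  let γ : ℝ → Space n := fun t => c + t • v + y t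
  let ν : ℝ → Space n := fun t => v + α • J (y t)
  have hzero : (0 : ℝ) • J = 0 := zero_smul ℝ J
  have hy₀ : y t₀ = e := by simp [y, hzero]
  have hγ₀ : γ t₀ = x₀ := by simp only [γ, c, hy₀]; abel
  have hν₀ : ν t₀ = u₀ := by simp only [ν, v, hy₀, sub_add_cancel]
  have hy : HasDerivAt y (α • J (y t₀)) t₀ :=
    (hasDerivAt_exp_smul_apply J _ e).scomp t₀
      (((hasDerivAt_id t₀).sub_const t₀).mul_const α) |>.congr_deriv (by simp [y, hzero])
  have hγ : HasDerivAt γ (ν t₀) t₀ := by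
    simpa using (((hasDerivAt_id t₀).smul_const v).const_add c).fun_add hy
  have hν : HasDerivAt ν (α • J (α • J (y t₀))) t₀ :=
    ((J.hasFDerivAt.comp_hasDerivAt t₀ hy).const_smul α).const_add v
  have hpath (t : ℝ) : T t (γ t) (ν t) r s = T t₀ (γ t₀) (ν t₀) r s := by
    simpa only [γ, ν, hy₀] using hC.density_vortex_motion hT h hA hJ he hα.symm hr hs t t₀ c v
  have hacc := hT.fderiv_velocity_acceleration_eq_zero hr₀ hγ hν (.of_forall hpath)
    (.of_forall fun t => hC.density_free_motion hT hr₀ (hs ▸ hA _) t t₀ (γ t₀) (ν t₀))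
  rw [hγ₀, hν₀, hy₀] at hacc
  simpa [hw] using hacc

end VelocityIndependence

section Classification

variable {n : ℕ} {P : ℝ → ℝ → ℝ} {A : Set ℝ} {T : ℝ → Space n → Space n → ℝ → ℝ → ℝ}

/-- The pressure varies to first order along some smooth curve of states which passes through
`(r, s)` and keeps the entropy in `A`. -/
def PressureVaries (P : ℝ → ℝ → ℝ) (A : Set ℝ) (r s : ℝ) : Prop :=
  ∃ R σ : ℝ → ℝ, ContDiff ℝ ∞ R ∧ ContDiff ℝ ∞ σ ∧ R 0 = r ∧ σ 0 = s ∧ (∀ z, σ z ∈ A) ∧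
    deriv (fun z => P (R z) (σ z)) 0 ≠ 0

theorem pressureVaries_of_deriv_density {r s : ℝ} (hs : s ∈ A)
    (h : deriv (fun r' => P r' s) r ≠ 0) : PressureVaries P A r s := by
  refine ⟨fun z => r + z, fun _ => s, by fun_prop, by fun_prop, by simp, rfl, fun _ => hs, ?_⟩
  rwa [deriv_comp_const_add (f := fun r' => P r' s), add_zero]

theorem pressureVaries_of_deriv_entropy {r s : ℝ} (h : deriv (fun s' => P r s') s ≠ 0) :
    PressureVaries P univ r s := by
  refine ⟨fun _ => r, fun z => s + z, by fun_prop, by fun_prop, rfl, by simp, fun _ => mem_univ _,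
    ?_⟩
  rwa [deriv_comp_const_add (f := fun s' => P r s'), add_zero]

theorem PressureVaries.entropy_mem {r s : ℝ} (h : PressureVaries P A r s) : s ∈ A := by
  obtain ⟨R, σ, -, -, -, rfl, hA, -⟩ := h
  exact hA 0

theorem PressureVaries.exists_deriv_pos {r s : ℝ} (h : PressureVaries P A r s) (q : ℝ) :
    ∃ R σ : ℝ → ℝ, ContDiff ℝ ∞ R ∧ ContDiff ℝ ∞ σ ∧ R q = r ∧ σ q = s ∧ (∀ z, σ z ∈ A) ∧
      0 < deriv (fun z => P (R z) (σ z)) q := by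
  obtain ⟨R, σ, hR, hσ, hr, hs, hA, hd⟩ := h
  rcases hd.lt_or_gt with hneg | hpos
  · refine ⟨fun z => R (q - z), fun z => σ (q - z), by fun_prop, by fun_prop, by simpa, by simpa,
      fun _ => hA _, ?_⟩
    rw [deriv_comp_const_sub (f := fun z => P (R z) (σ z)), sub_self]
    exact neg_pos.2 hneg
  · refine ⟨fun z => R (z - q), fun z => σ (z - q), by fun_prop, by fun_prop, by simpa, by simpa,
      fun _ => hA _, ?_⟩
    rwa [deriv_comp_sub_const (f := fun z => P (R z) (σ z)), sub_self]

theorem isVortexProfile_sqrt (hP : SmoothState P) {R σ : ℝ → ℝ} (hR : ContDiff ℝ ∞ R)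
    (hσ : ContDiff ℝ ∞ σ) :
    IsVortexProfile P {z | 0 < R z ∧ 0 < deriv (fun z => P (R z) (σ z)) z}
      (fun z => √(deriv (fun z => P (R z) (σ z)) z / R z)) R σ := by
  have hpos : IsOpen {z | 0 < R z} := isOpen_lt continuous_const hR.continuous
  have hp : ContDiffOn ℝ ∞ (fun z => P (R z) (σ z)) {z | 0 < R z} :=
    ContDiffOn.comp (g := fun z : ℝ × ℝ => P z.1 z.2) hP (hR.prodMk hσ).contDiffOn fun _ hz => hz
  have hp' := hp.deriv_of_isOpen hpos (m := ∞) (by simp)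
  exact
    { isOpen := hp'.continuousOn.isOpen_inter_preimage hpos isOpen_Ioi
      smooth_angular_velocity := ((hp'.mono fun _ hz => hz.1).div hR.contDiffOn
        fun _ hz => ne_of_gt hz.1).sqrt fun _ hz => (div_pos hz.2 hz.1).ne'
      smooth_density := hR.contDiffOn
      smooth_entropy := hσ.contDiffOn
      density_pos := fun _ hz => hz.1
      balance := fun z hz => by
        rw [Real.sq_sqrt (div_pos hz.2 hz.1).le, mul_div_cancel₀ _ (ne_of_gt hz.1)]
        exact ((hp.contDiffAt (hpos.mem_nhds hz.1)).differentiableAt (by simp)).hasDerivAt }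

variable {r s : ℝ}

theorem IsConserved.fderiv_velocity_eq_zero (hC : IsConserved P A T) (hT : SmoothDensity T)
    (hP : SmoothState P) (hn : 1 < n) (hr : 0 < r) (hvar : PressureVaries P A r s) (t : ℝ)
    (x u : Space n) : fderiv ℝ (fun u => T t x u r s) u = 0 := by
  ext a
  obtain ⟨J, hJ, e, rfl⟩ := exists_mem_skewAdjoint_apply_apply_eq (by simpa using hn) a
  obtain ⟨R, σ, hR, hσ, hRe, hσe, hA, hd⟩ := hvar.exists_deriv_pos (centrifugalPotential J e)
  have hRe₀ : 0 < R (centrifugalPotential J e) := hRe ▸ hr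
  exact hC.fderiv_velocity_centripetal_eq_zero hT (isVortexProfile_sqrt hP hR hσ) hA hJ
    ⟨hRe₀, hd⟩ (Real.sqrt_pos.2 (div_pos hd hRe₀)).ne' hRe hσe t x u

theorem IsConserved.density_eq_rest (hC : IsConserved P A T) (hT : SmoothDensity T)
    (hP : SmoothState P) (hn : 1 < n) (hr : 0 < r) (hvar : PressureVaries P A r s) (t : ℝ)
    (x u : Space n) : T t x u r s = T t x 0 r s := by
  refine is_const_of_fderiv_eq_zero (𝕜 := ℝ) (f := fun u => T t x u r s) (fun u => ?_)
    (hC.fderiv_velocity_eq_zero hT hP hn hr hvar t x) u 0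
  exact (hT.contDiffAt_comp contDiffAt_const contDiffAt_const contDiffAt_id contDiffAt_const
    contDiffAt_const hr).differentiableAt (by simp)

theorem IsConserved.density_eq_origin (hC : IsConserved P A T) (hT : SmoothDensity T)
    (hP : SmoothState P) (hn : 1 < n) (hr : 0 < r) (hvar : PressureVaries P A r s) (t : ℝ)
    (x u : Space n) : T t x u r s = T 0 0 0 r s := by
  have hrest := hC.density_eq_rest hT hP hn hr hvar
  have hmove {t t' : ℝ} (htt' : t' ≠ t) (x x' : Space n) : T t' x' 0 r s = T t x 0 r s := by
    have hfree := hC.density_free_motion hT hr hvar.entropy_mem t' t x ((t' - t)⁻¹ • (x' - x))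
    rwa [smul_inv_smul₀ (sub_ne_zero.2 htt'), add_sub_cancel, hrest t', hrest t] at hfree
  obtain ⟨t', ht', ht'₀⟩ : ∃ t' : ℝ, t' ≠ t ∧ t' ≠ 0 := by
    simpa using ((finite_singleton (0 : ℝ)).insert t).exists_notMem
  rw [hrest, ← hmove ht' x 0, hmove ht'₀ 0 0]

theorem IsConserved.density_eq_of_pressureVaries (hC : IsConserved P A T) (hT : SmoothDensity T)
    (hP : SmoothState P) (hn : 1 < n) (hr : 0 < r) (hvar : PressureVaries P A r s) (t : ℝ)
    (x u : Space n) {ρ : ℝ} (hρ : 0 < ρ) : T t x u ρ s = ρ * T 0 0 0 1 s := by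
  have hmul {r' : ℝ} (hr' : 0 < r') := hC.density_eq_mul hT (by omega) hr' hvar.entropy_mem
  have horigin := hC.density_eq_origin hT hP hn hr hvar t x u
  rw [hmul hr, hmul hr 0, mul_right_inj' hr.ne'] at horigin
  rw [hmul hρ, horigin]

theorem SmoothDensity.contDiff_entropy (hT : SmoothDensity T) (t : ℝ) (x u : Space n) {ρ : ℝ}
    (hρ : 0 < ρ) : ContDiff ℝ ∞ fun s => T t x u ρ s :=
  contDiff_iff_contDiffAt.2 fun _ => hT.contDiffAt_comp contDiffAt_const contDiffAt_const
    contDiffAt_const contDiffAt_const contDiffAt_id hρ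

theorem IsConserved.exists_eq_density_mul (hC : IsConserved P univ T) (hT : SmoothDensity T)
    (hP : SmoothState P) (hN : NondegenerateState P) (hn : 1 < n) :
    ∃ f : ℝ → ℝ, ContDiff ℝ ∞ f ∧ ∀ t x u ρ s, 0 < ρ → T t x u ρ s = ρ * f s := by
  have hf := hT.contDiff_entropy 0 0 0 one_pos
  refine ⟨_, hf, fun t x u ρ s hρ => congrFun (Continuous.ext_on hN
    (hT.contDiff_entropy t x u hρ).continuous (continuous_const.mul hf.continuous) ?_) s⟩
  rintro s' ⟨r, hr, hd⟩
  exact hC.density_eq_of_pressureVaries hT hP hn hr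
    (hd.elim (pressureVaries_of_deriv_density (mem_univ s')) pressureVaries_of_deriv_entropy)
    t x u hρ

theorem IsConserved.exists_eq_const_mul (hC : IsConserved P {s} T) (hT : SmoothDensity T)
    (hP : SmoothState P) (hn : 1 < n) (hr : 0 < r) (hd : deriv (fun r' => P r' s) r ≠ 0) :
    ∃ c : ℝ, ∀ t x u ρ, 0 < ρ → T t x u ρ s = c * ρ :=
  ⟨T 0 0 0 1 s, fun t x u _ hρ => (hC.density_eq_of_pressureVaries hT hP hn hr
    (pressureVaries_of_deriv_density rfl hd) t x u hρ).trans (mul_comm _ _)⟩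

end Classification

end CompressibleFluid

end

theorem proposition1 (n : ℕ) (hn : 1 < n) (P : ℝ → ℝ → ℝ)
    (hP : CompressibleFluid.SmoothState P) :
    -- mass and generalized entropy are constants of motion for every equation of state
    (CompressibleFluid.IsConstantOfMotion (n := n) P (fun _ _ _ ρ _ => ρ) ∧
      ∀ f : ℝ → ℝ, ContDiff ℝ ∞ f → f ≠ 0 →
        CompressibleFluid.IsConstantOfMotion (n := n) P (fun _ _ _ ρ S => ρ * f S)) ∧
    -- there are no others
    (CompressibleFluid.NondegenerateState P →
      ∀ T : ℝ → CompressibleFluid.Space n → CompressibleFluid.Space n → ℝ → ℝ → ℝ,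
        CompressibleFluid.SmoothDensity T → CompressibleFluid.IsConserved P univ T →
        ∃ f : ℝ → ℝ, ContDiff ℝ ∞ f ∧
          ∀ t x u ρ S, 0 < ρ → T t x u ρ S = ρ * f S) ∧
    -- in flows of constant entropy, with a nonconstant barotropic pressure, only mass remains
    (∀ s₀ : ℝ, (∃ r : ℝ, 0 < r ∧ deriv (fun r' => P r' s₀) r ≠ 0) →
      ∀ T : ℝ → CompressibleFluid.Space n → CompressibleFluid.Space n → ℝ → ℝ → ℝ,
        CompressibleFluid.SmoothDensity T → CompressibleFluid.IsConserved P {s₀} T →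
        ∃ c : ℝ, ∀ t x u ρ, 0 < ρ → T t x u ρ s₀ = c * ρ) := by
  refine ⟨⟨?_, fun f hf hf₀ =>
      CompressibleFluid.isConstantOfMotion_density_mul hf.continuous hf₀⟩,
    fun hN T hT hC => hC.exists_eq_density_mul hT hP hN hn,
    fun s₀ ⟨r, hr, hd⟩ T hT hC => hC.exists_eq_const_mul hT hP hn hr hd⟩
  simpa using CompressibleFluid.isConstantOfMotion_density_mul (n := n) (P := P) (f := fun _ => 1)
    continuous_const one_ne_zero
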